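/- Let $q\in\mathbb C$ be nonzero with $q^4\neq 1$. Let $\Gamma$ be a distance-regular graph with (finite) vertex set $X$, path-length distance $\partial$, diameter $D\ge 3$ and adjacency matrix $A$, and let $M\subseteq \mathrm{Mat}_X(\mathbb C)$ be the algebra generated by $A$. Let $\{E_i\}_{i=0}^D$ be an ordering of the primitive idempotents of $\Gamma$, i.e. a basis of $M$ with $E_0=|X|^{-1}J$ ($J$ the all-ones matrix), $\sum_i E_i=I$ and $E_iE_j=\delta_{ij}E_i$. Assume that the ordering $\{E_i\}_{i=1}^D$ is $Q$-polynomial: writing $\circ$ for the entrywise product and $E_i\circ E_j=|X|^{-1}\sum_{h=0}^D q^h_{ij}E_h$, for all $0\le i,j\le D$ the scalar $q^1_{ij}$ is zero if $|i-j|>1$ and nonzero if $|i-j|=1$. Fix $x\in X$. For $0\le i\le D$ let $E_i^*$ be the diagonal matrix with $(y,y)$-entry $1$ if $\partial(x,y)=i$ and $0$ otherwise, and let $A^*$ be the diagonal matrix with $(y,y)$-entry $|X|(E_1)_{xy}$. Let $T\subseteq\mathrm{Mat}_X(\mathbb C)$ be the subconstituent algebra, generated by $M$ and $E_0^*,\dots,E_D^*$.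 Write $A=\sum_i\theta_iE_i$ and $A^*=\sum_i\theta_i^*E_i^*$, and assume that the $Q$-polynomial structure has $q$-Racah type: there are $u,v,w,u^*,v^*,w^*\in\mathbb C$ with $u,v,u^*,v^*$ nonzero and $$\theta_i=w+uq^{2i-D}+vq^{D-2i},\qquad \theta_i^*=w^*+u^*q^{2i-D}+v^*q^{D-2i}\qquad(0\le i\le D).$$ Let $a,b\in\mathbb C$ satisfy $a^2=u/v$ and $b^2=u^*/v^*$, and put $$\mathbf A=\frac{A-wI}{av},\qquad \mathbf B=\frac{A^*-w^*I}{bv^*}.$$ A $T$-module is a subspace $W\subseteq\mathbb C^X$ with $TW\subseteq W$; it is irreducible if it is nonzero and contains no $T$-modules other than $0$ and $W$. Let $W$ be an irreducible $T$-module that is thin, i.e. $\dim E_i^*W\le 1$ for $0\le i\le D$. Let $\rho=\min\{i: E_i^*W\ne0\}$ be its endpoint, $\tau=\min\{i:E_iW\neq 0\}$ its dual endpoint, and $d=|\{i:E_i^*W\neq0\}|-1$ its diameter. Then $\tau+d\le D$, $\rho+d\le D$, the subspace $W$ is invariant under $\mathbf A$, $\mathbf B$, $E_\tau,\dots,E_{\tau+d}$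 and $E_\rho^*,\dots,E_{\rho+d}^*$, and the restrictions to $W$ of $$\bigl(\mathbf A,\{E_i\}_{i=\tau}^{\tau+d},\mathbf B,\{E_i^*\}_{i=\rho}^{\rho+d}\bigr)$$ form a Leonard system on $W$ of $q$-Racah type. Its eigenvalue sequence is $$a(W)q^{2i-d}+a(W)^{-1}q^{d-2i}\quad(0\le i\le d),\qquad a(W)=aq^{2\tau+d-D},$$ and its dual eigenvalue sequence is $$b(W)q^{2i-d}+b(W)^{-1}q^{d-2i}\quad(0\le i\le d),\qquad b(W)=bq^{2\rho+d-D}.$$ Here a Leonard system on a complex vector space $W$ of dimension $d+1$ is a sequence $(\mathcal A,\{F_i\}_{i=0}^d,\mathcal B,\{F_i^*\}_{i=0}^d)$ of elements of $\mathrm{End}(W)$ such that $\mathcal A$ and $\mathcal B$ each have $d+1$ distinct eigenvalues; $\{F_i\}$ and $\{F_i^*\}$ are orderings of the primitive idempotents of $\mathcal A$ and $\mathcal B$ respectively (the projections onto an eigenspace that vanish on the other eigenspaces); and $F_i\mathcal BF_j$ and $F_i^*\mathcal AF_j^*$ are zero if $|i-j|>1$ and nonzero if $|i-j|=1$ $(0\le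 i,j\le d)$. Its eigenvalue sequence (dual eigenvalue sequence) lists the eigenvalues of $\mathcal A$ (of $\mathcal B$) belonging to $F_0,\dots,F_d$ (to $F_0^*,\dots,F_d^*$). It has $q$-Racah type if there are nonzero $\alpha,\beta\in\mathbb C$ such that these sequences are $\alpha q^{2i-d}+\alpha^{-1}q^{d-2i}$ and $\beta q^{2i-d}+\beta^{-1}q^{d-2i}$ for $0\le i\le d$. -/

import Mathlib

open scoped Matrix

noncomputable section

/-! ### Leonard systems -/

section Leonard

variable {V : Type*} [AddCommGroup V] [Module ℂ V]

/-- `A` is multiplicity-free: it has `dim V` distinct eigenvalues. -/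
def IsMultiplicityFree (A : Module.End ℂ V) : Prop :=
  {μ : ℂ | A.HasEigenvalue μ}.ncard = Module.finrank ℂ V

/-- `F` is the primitive idempotent of `A` for the eigenvalue `μ`: the map `F - I` is zero on the
`μ`-eigenspace of `A` and `F` is zero on all the other eigenspaces of `A`. -/
def IsPrimitiveIdempotentFor (A : Module.End ℂ V) (μ : ℂ) (F : Module.End ℂ V) : Prop :=
  A.HasEigenvalue μ ∧ (∀ v ∈ A.eigenspace μ, F v = v) ∧
    ∀ ν : ℂ, ν ≠ μ → ∀ v ∈ A.eigenspace ν, F v = 0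

/-- `E 0, …, E d` is an ordering (without repetition) of all the primitive idempotents of `A`. -/
def IsPrimitiveIdempotentOrdering {d : ℕ} (A : Module.End ℂ V)
    (E : Fin (d + 1) → Module.End ℂ V) : Prop :=
  Function.Injective E ∧ Set.range E = {F | ∃ μ : ℂ, IsPrimitiveIdempotentFor A μ F}

/-- `(A, {E_i}, B, {F_i})` is a Leonard system of diameter `d` on `V`. -/
structure IsLeonardSystem (d : ℕ) (A : Module.End ℂ V) (E : Fin (d + 1) → Module.End ℂ V)
    (B : Module.End ℂ V) (F : Fin (d + 1) → Module.End ℂ V) : Prop where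
  finrank_eq : Module.finrank ℂ V = d + 1
  multiplicityFree : IsMultiplicityFree A
  dual_multiplicityFree : IsMultiplicityFree B
  ordering : IsPrimitiveIdempotentOrdering A E
  dual_ordering : IsPrimitiveIdempotentOrdering B F
  mul_eq_zero : ∀ i j : Fin (d + 1), 1 < |(i : ℤ) - (j : ℤ)| → E i * B * E j = 0
  mul_ne_zero : ∀ i j : Fin (d + 1), |(i : ℤ) - (j : ℤ)| = 1 → E i * B * E j ≠ 0
  dual_mul_eq_zero : ∀ i j : Fin (d + 1), 1 < |(i : ℤ) - (j : ℤ)| → F i * A * F j = 0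
  dual_mul_ne_zero : ∀ i j : Fin (d + 1), |(i : ℤ) - (j : ℤ)| = 1 → F i * A * F j ≠ 0

/-- `θ i` is the eigenvalue of `A` associated with the primitive idempotent `E i`. -/
def IsEigenvalueSequence {d : ℕ} (A : Module.End ℂ V) (E : Fin (d + 1) → Module.End ℂ V)
    (θ : Fin (d + 1) → ℂ) : Prop :=
  ∀ i, IsPrimitiveIdempotentFor A (θ i) (E i)

/-- The sequence `a q^(2i-d) + a⁻¹ q^(d-2i)` for `0 ≤ i ≤ d`. -/
def qRacahSequence (q : ℂ) (d : ℕ) (a : ℂ) (i : Fin (d + 1)) : ℂ :=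
  a * q ^ (2 * (i : ℤ) - (d : ℤ)) + a⁻¹ * q ^ ((d : ℤ) - 2 * (i : ℤ))

/-- A Leonard system `(A, {E_i}, B, {F_i})` has `q`-Racah type. -/
def HasQRacahType (q : ℂ) {d : ℕ} (A : Module.End ℂ V) (E : Fin (d + 1) → Module.End ℂ V)
    (B : Module.End ℂ V) (F : Fin (d + 1) → Module.End ℂ V) : Prop :=
  ∃ a b : ℂ, a ≠ 0 ∧ b ≠ 0 ∧ IsEigenvalueSequence A E (qRacahSequence q d a) ∧
    IsEigenvalueSequence B F (qRacahSequence q d b)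

end Leonard

/-! ### Distance-regular graphs, `Q`-polynomial structures, subconstituent algebras -/

section Graph

variable {X : Type*} [Fintype X] [DecidableEq X]

/-- A finite connected graph is distance-regular if for `0 ≤ h, i, j ≤ D` and vertices `x, y` at
distance `h`, the number of `z` with `∂(x,z) = i` and `∂(y,z) = j` depends only on `h, i, j`. -/
structure IsDistanceRegular (G : SimpleGraph X) : Prop where
  connected : G.Connected
  regular : ∀ h i j : ℕ, h ≤ G.diam → i ≤ G.diam → j ≤ G.diam → ∃ p : ℕ, ∀ x y : X,
    G.dist x y = h → (Finset.univ.filter fun z => G.dist x z = i ∧ G.dist y z = j).card = p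

/-- The `i`-th distance matrix `A_i`; `A_1` is the adjacency matrix. -/
def distanceMatrix (G : SimpleGraph X) (i : ℕ) : Matrix X X ℂ :=
  Matrix.of fun y z => if G.dist y z = i then 1 else 0

/-- The Bose-Mesner algebra `M`, generated by the adjacency matrix. -/
def boseMesner (G : SimpleGraph X) : Subalgebra ℂ (Matrix X X ℂ) :=
  Algebra.adjoin ℂ {distanceMatrix G 1}

/-- `E 0, …, E D` are the primitive idempotents of the graph: a basis of the Bose-Mesner
algebra consisting of mutually orthogonal idempotents with sum `I`, where `E 0 = |X|⁻¹ J`. -/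
structure IsPrimitiveIdempotents (G : SimpleGraph X)
    (E : Fin (G.diam + 1) → Matrix X X ℂ) : Prop where
  linearIndependent : LinearIndependent ℂ E
  span_eq : Submodule.span ℂ (Set.range E) = Subalgebra.toSubmodule (boseMesner G)
  zero_eq : E 0 = (Fintype.card X : ℂ)⁻¹ • Matrix.of fun _ _ => (1 : ℂ)
  sum_eq : ∑ i, E i = 1
  mul_eq : ∀ i j, E i * E j = if i = j then E i else 0

/-- `κ i j h` is the Krein parameter `q^h_{ij}`. -/
def IsKreinParameters (G : SimpleGraph X) (E : Fin (G.diam + 1) → Matrix X X ℂ)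
    (κ : Fin (G.diam + 1) → Fin (G.diam + 1) → Fin (G.diam + 1) → ℂ) : Prop :=
  ∀ i j, E i ⊙ E j = (Fintype.card X : ℂ)⁻¹ • ∑ h, κ i j h • E h

/-- The ordering `E 1, …, E D` of the nontrivial primitive idempotents is `Q`-polynomial. (The
Krein parameters are unique, since the `E h` are linearly independent.) -/
def IsQPolynomial (G : SimpleGraph X) (E : Fin (G.diam + 1) → Matrix X X ℂ) : Prop :=
  ∃ κ, IsKreinParameters G E κ ∧ ∀ i j : Fin (G.diam + 1),
    (1 < |(i : ℤ) - (j : ℤ)| → κ i j 1 = 0) ∧ (|(i : ℤ) - (j : ℤ)| = 1 → κ i j 1 ≠ 0)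

/-- The `i`-th dual idempotent `E_i^*` with respect to `x`. -/
def dualIdempotent (G : SimpleGraph X) (x : X) (i : Fin (G.diam + 1)) : Matrix X X ℂ :=
  Matrix.diagonal fun y => if G.dist x y = (i : ℕ) then 1 else 0

/-- The dual Bose-Mesner algebra `M^*` with respect to `x`. -/
def dualBoseMesner (G : SimpleGraph X) (x : X) : Subalgebra ℂ (Matrix X X ℂ) :=
  Algebra.adjoin ℂ (Set.range (dualIdempotent G x))

/-- The dual adjacency matrix `A^* = A_1^*` with respect to `x`. -/
def dualAdjacency (G : SimpleGraph X) (E : Fin (G.diam + 1) → Matrix X X ℂ) (x : X) :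
    Matrix X X ℂ :=
  Matrix.diagonal fun y => (Fintype.card X : ℂ) * E 1 x y

/-- The subconstituent algebra `T = T(x)`, generated by `M` and `M^*`. -/
def subconstituentAlgebra (G : SimpleGraph X) (x : X) : Subalgebra ℂ (Matrix X X ℂ) :=
  boseMesner G ⊔ dualBoseMesner G x

/-- A `T`-module: a subspace `W` of the standard module `ℂ^X` with `S W ⊆ W` for all `S ∈ T`. -/
def IsTModule (T : Subalgebra ℂ (Matrix X X ℂ)) (W : Submodule ℂ (X → ℂ)) : Prop :=
  ∀ S ∈ T, ∀ w ∈ W, S *ᵥ w ∈ W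

/-- An irreducible `T`-module. -/
def IsIrreducibleTModule (T : Subalgebra ℂ (Matrix X X ℂ)) (W : Submodule ℂ (X → ℂ)) : Prop :=
  IsTModule T W ∧ W ≠ ⊥ ∧ ∀ U : Submodule ℂ (X → ℂ), IsTModule T U → U ≤ W → U = ⊥ ∨ U = W

/-- The subspace `S W`. -/
def matrixImage (S : Matrix X X ℂ) (W : Submodule ℂ (X → ℂ)) : Submodule ℂ (X → ℂ) :=
  W.map (Matrix.toLin' S)

/-- The endpoint `min {i | E_i^* W ≠ 0}`. -/
def moduleEndpoint (G : SimpleGraph X) (x : X) (W : Submodule ℂ (X → ℂ)) : ℕ :=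
  sInf {i : ℕ | ∃ j : Fin (G.diam + 1), (j : ℕ) = i ∧ matrixImage (dualIdempotent G x j) W ≠ ⊥}

/-- The dual endpoint `min {i | E_i W ≠ 0}`. -/
def moduleDualEndpoint (G : SimpleGraph X) (E : Fin (G.diam + 1) → Matrix X X ℂ)
    (W : Submodule ℂ (X → ℂ)) : ℕ :=
  sInf {i : ℕ | ∃ j : Fin (G.diam + 1), (j : ℕ) = i ∧ matrixImage (E j) W ≠ ⊥}

/-- The diameter `|{i | E_i^* W ≠ 0}| - 1`. -/
def moduleDiameter (G : SimpleGraph X) (x : X) (W : Submodule ℂ (X → ℂ)) : ℕ :=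
  {i : Fin (G.diam + 1) | matrixImage (dualIdempotent G x i) W ≠ ⊥}.ncard - 1

/-- `W` is thin: `dim E_i^* W ≤ 1` for `0 ≤ i ≤ D`. -/
def IsThinModule (G : SimpleGraph X) (x : X) (W : Submodule ℂ (X → ℂ)) : Prop :=
  ∀ i : Fin (G.diam + 1), Module.finrank ℂ (matrixImage (dualIdempotent G x i) W) ≤ 1

/-- The matrix `S` leaves `W` invariant and acts on it as the linear map `f`. -/
def ActsOnAs (W : Submodule ℂ (X → ℂ)) (S : Matrix X X ℂ) (f : Module.End ℂ W) : Prop :=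
  ∀ w : W, S *ᵥ (w : X → ℂ) = (f w : X → ℂ)

end Graph

end

/-!
Let `P i` and `Q i` be the restrictions to `W` of the dual idempotents and of the primitive
idempotents of the graph. Both are complete systems of orthogonal idempotents (some of them zero).
The adjacency matrix is block tridiagonal with respect to the dual idempotents by the triangle
inequality, and the dual adjacency matrix is block tridiagonal with respect to the `E i`, because
the squared Frobenius norm of `E i * B * E j`, where `B` is the dual adjacency matrix, is a multiple
of the Krein parameter `κ i j 1` (`IsPrimitiveIdempotents.mul_dualAdjacency_mul_eq_zero`).

Since the adjacency matrix generates the Bose-Mesner algebra, its eigenvalues are distinct. The dual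
eigenvalues are distinct as well: in the `Q`-polynomial case `E 1` generates the Bose-Mesner algebra
under the entrywise product (`IsPrimitiveIdempotents.apply_eq_of_apply_one_eq`), while powers of the
adjacency matrix separate vertices at different distances from `x`. Lagrange interpolation then
expresses all idempotents as polynomials in the two operators, so irreducibility of `W` says that
no subspace is invariant under one of the operators and the idempotents of the other one.

Irreducibility implies that the support of either system is an interval and that neighbouring blocks
are nonzero, since otherwise a part of the index set would split off (`IsIrreducibleTridiagonal`).
When `W` is thin, an eigenvector of the adjacency matrix in `W` is determined by its component at
the endpoint, so `W` is dual thin; as ranks add up to the dimension, both supports have `dim W`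
elements. These are the conditions defining a Leonard system
(`IsIrreducibleTridiagonal.isLeonardSystem`), and the eigenvalue sequences come from shifting the
index in the `q`-Racah formulas (`qRacahSequence_eq`).
-/

/-! ### Complete systems of orthogonal idempotents -/

open Polynomial in
/-- If `P` consists of eigenvectors of `T` with eigenvalue `c`, then a polynomial `p` in `T` acts
on `P` as the scalar `p c`. -/
theorem aeval_mul_of_mul_eq_smul {R : Type*} [Ring R] [Algebra ℂ R] {T P : R} {c : ℂ}
    (h : T * P = c • P) (p : ℂ[X]) : aeval T p * P = p.eval c • P := by
  induction p using Polynomial.induction_on' with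
  | add p q hp hq => rw [map_add, add_mul, hp, hq, eval_add, add_smul]
  | monomial n r =>
    have hn : T ^ n * P = c ^ n • P := by
      induction n with
      | zero => simp
      | succ n ih =>
        rw [pow_succ, mul_assoc, h, mul_smul_comm, ih, smul_smul, pow_succ, mul_comm]
    rw [aeval_monomial, mul_assoc, hn, eval_monomial, ← Algebra.smul_def, smul_smul]

theorem CompleteOrthogonalIdempotents.sum_smul_mul {R ι : Type*} [Ring R] [Algebra ℂ R]
    [Fintype ι] {P : ι → R} (hP : CompleteOrthogonalIdempotents P) (θ : ι → ℂ) (i : ι) :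
    (∑ j, θ j • P j) * P i = θ i • P i := by
  classical
  rw [Finset.sum_mul, Finset.sum_eq_single i]
  · rw [smul_mul_assoc, (hP.idem i).eq]
  · intro j _ hj
    rw [smul_mul_assoc, hP.ortho hj, smul_zero]
  · simp

open Polynomial in
/-- An idempotent of a complete orthogonal system is a polynomial in each linear combination
whose coefficients are distinct on the nonzero idempotents (Lagrange interpolation). -/
theorem CompleteOrthogonalIdempotents.exists_aeval_eq {R ι : Type*} [Ring R] [Algebra ℂ R]
    [Fintype ι] {P : ι → R} (hP : CompleteOrthogonalIdempotents P) {θ : ι → ℂ} {T : R}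
    (hT : T = ∑ j, θ j • P j) (hθ : Set.InjOn θ {i | P i ≠ 0}) (i : ι) :
    ∃ p : ℂ[X], aeval T p = P i := by
  classical
  by_cases hi : P i = 0
  · exact ⟨0, by simp [hi]⟩
  let s : Finset ι := Finset.univ.filter fun j => P j ≠ 0
  have hs : Set.InjOn θ s := by simpa [s] using hθ
  refine ⟨Lagrange.basis s θ i, ?_⟩
  rw [← mul_one (aeval T _), ← hP.complete, Finset.mul_sum, Finset.sum_eq_single i]
  · rw [aeval_mul_of_mul_eq_smul (hT ▸ hP.sum_smul_mul θ i),
      Lagrange.eval_basis_self hs (by simp [s, hi]), one_smul]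
  · intro j _ hj
    by_cases hj0 : P j = 0
    · simp [hj0]
    rw [aeval_mul_of_mul_eq_smul (hT ▸ hP.sum_smul_mul θ j),
      Lagrange.eval_basis_of_ne hj.symm (by simp [s, hj0]), zero_smul]
  · simp

section Tridiagonal

variable {V : Type*} [AddCommGroup V] [Module ℂ V]

theorem aeval_apply_mem {T : Module.End ℂ V} {U : Submodule ℂ V} (hU : ∀ v ∈ U, T v ∈ U)
    (p : Polynomial ℂ) {v : V} (hv : v ∈ U) : Polynomial.aeval T p v ∈ U := by
  induction p using Polynomial.induction_on' with
  | add p q hp hq => simpa using U.add_mem hp hq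
  | monomial n r =>
    have hn : (T ^ n) v ∈ U := by
      induction n with
      | zero => simpa
      | succ n ih => rw [pow_succ']; exact hU _ ih
    rw [Polynomial.aeval_monomial, ← Algebra.smul_def]
    exact U.smul_mem r hn

theorem CompleteOrthogonalIdempotents.sum_apply {ι : Type*} [Fintype ι] {P : ι → Module.End ℂ V}
    (hP : CompleteOrthogonalIdempotents P) (v : V) : ∑ i, P i v = v := by
  have := congrArg (fun f : Module.End ℂ V => f v) hP.complete
  simpa using this

/-- The ranks of a complete system of orthogonal idempotents add up to the dimension, since the
rank of an idempotent is its trace. -/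
theorem CompleteOrthogonalIdempotents.sum_finrank_range [FiniteDimensional ℂ V] {ι : Type*}
    [Fintype ι] {P : ι → Module.End ℂ V} (hP : CompleteOrthogonalIdempotents P) :
    ∑ i, Module.finrank ℂ (LinearMap.range (P i)) = Module.finrank ℂ V := by
  have h := congrArg (LinearMap.trace ℂ V) hP.complete
  rw [map_sum, LinearMap.trace_one] at h
  have h' : ∀ i, LinearMap.trace ℂ V (P i) = Module.finrank ℂ (LinearMap.range (P i)) := fun i =>
    (LinearMap.IsIdempotentElem.isProj_range (P i) (hP.idem i)).trace
  simp only [h'] at h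
  exact_mod_cast h

/-- If the ranks are at most one, the dimension is the number of nonzero idempotents. -/
theorem CompleteOrthogonalIdempotents.ncard_eq_finrank [FiniteDimensional ℂ V] {ι : Type*}
    [Fintype ι] {P : ι → Module.End ℂ V} (hP : CompleteOrthogonalIdempotents P)
    (h1 : ∀ i, Module.finrank ℂ (LinearMap.range (P i)) ≤ 1) :
    {i | P i ≠ 0}.ncard = Module.finrank ℂ V := by
  classical
  rw [← hP.sum_finrank_range, Set.ncard_eq_toFinset_card', Finset.card_eq_sum_ones]
  refine Finset.sum_subset_zero_on_sdiff (Finset.subset_univ _) ?_ ?_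
  · intro i hi
    have : P i = 0 := by simpa using hi
    simp [this]
  · intro i hi
    have hi : P i ≠ 0 := by simpa using hi
    refine le_antisymm ?_ (h1 i)
    rw [Nat.one_le_iff_ne_zero, Ne, Submodule.finrank_eq_zero, LinearMap.range_eq_bot]
    exact hi

/-- In an irreducible situation an index set `S` cannot be split off: if `T` maps the sum of the
subspaces `P i V`, `i ∈ S`, into itself, then this sum is zero or everything. -/
theorem CompleteOrthogonalIdempotents.eq_zero_or_eq_zero {ι : Type*} [Fintype ι]
    {P : ι → Module.End ℂ V} (hP : CompleteOrthogonalIdempotents P) {T : Module.End ℂ V}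
    (hirr : ∀ U : Submodule ℂ V, (∀ v ∈ U, T v ∈ U) → (∀ i, ∀ v ∈ U, P i v ∈ U) → U = ⊥ ∨ U = ⊤)
    (S : Set ι) (hS : ∀ i ∈ S, ∀ j ∉ S, P j * T * P i = 0) :
    (∀ i ∈ S, P i = 0) ∨ ∀ j ∉ S, P j = 0 := by
  classical
  -- The sum of the `P i V` with `i ∈ S`, as the common kernel of the other idempotents.
  let U : Submodule ℂ V := ⨅ j ∈ Sᶜ, LinearMap.ker (P j)
  have hU : ∀ v, v ∈ U ↔ ∀ j ∉ S, P j v = 0 := by simp [U, Submodule.mem_iInf]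
  have hmul : ∀ i j, i ≠ j → ∀ v, P i (P j v) = 0 := fun i j hij v =>
    congrArg (fun f : Module.End ℂ V => f v) (hP.ortho hij)
  have hT : ∀ v ∈ U, T v ∈ U := by
    intro v hv
    rw [hU] at hv ⊢
    intro j hj
    conv_lhs => rw [← hP.sum_apply v]
    rw [map_sum, map_sum]
    refine Finset.sum_eq_zero fun i _ => ?_
    by_cases hi : i ∈ S
    · exact congrArg (fun f : Module.End ℂ V => f v) (hS i hi j hj)
    · simp [hv i hi]
  have hPU : ∀ i, ∀ v ∈ U, P i v ∈ U := by
    intro i v hv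
    rw [hU] at hv ⊢
    intro j hj
    by_cases hij : j = i
    · subst hij
      simp [hv j hj]
    · exact hmul j i hij v
  rcases hirr U hT hPU with h | h
  · left
    intro i hi
    ext v
    have : P i v ∈ U := (hU _).2 fun j hj => hmul j i (fun e => hj (e ▸ hi)) v
    simpa [h] using this
  · right
    intro j hj
    ext v
    have : v ∈ U := h ▸ Submodule.mem_top
    exact (hU v).1 this j hj

/-- `T` acts on `V` in a block tridiagonal way with respect to the complete system `P` of
orthogonal idempotents, and no proper nonzero subspace is invariant under `T` and all `P i`. -/
structure IsIrreducibleTridiagonal {n : ℕ} (T : Module.End ℂ V) (P : Fin n → Module.End ℂ V) :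
    Prop where
  complete : CompleteOrthogonalIdempotents P
  mul_eq_zero : ∀ i j : Fin n, 1 < |(i : ℤ) - (j : ℤ)| → P i * T * P j = 0
  irreducible : ∀ U : Submodule ℂ V, (∀ v ∈ U, T v ∈ U) → (∀ i, ∀ v ∈ U, P i v ∈ U) →
    U = ⊥ ∨ U = ⊤

namespace IsIrreducibleTridiagonal

variable {n : ℕ} {T : Module.End ℂ V} {P : Fin n → Module.End ℂ V}

/-- If a neighbouring block were zero, one of the two halves of the index set would split off. -/
theorem mul_ne_zero (h : IsIrreducibleTridiagonal T P) {i j : Fin n} (hi : P i ≠ 0) (hj : P j ≠ 0)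
    (hij : |(i : ℤ) - (j : ℤ)| = 1) : P i * T * P j ≠ 0 := by
  intro h0
  rcases (abs_eq zero_le_one).1 hij with hij | hij
  · have hS : ∀ k ∈ {k : Fin n | k ≤ j}, ∀ l ∉ {k : Fin n | k ≤ j}, P l * T * P k = 0 := by
      intro k hk l hl
      simp only [Set.mem_ofPred_eq, Fin.le_def] at hk hl
      by_cases hkl : 1 < |(l : ℤ) - (k : ℤ)|
      · exact h.mul_eq_zero l k hkl
      · rw [not_lt, abs_le] at hkl
        obtain rfl : l = i := by ext; omega
        obtain rfl : k = j := by ext; omega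
        exact h0
    rcases h.complete.eq_zero_or_eq_zero h.irreducible _ hS with h1 | h1
    · exact hj (h1 j (by simp))
    · exact hi (h1 i (by simp only [Set.mem_ofPred_eq, Fin.le_def]; omega))
  · have hS : ∀ k ∈ {k : Fin n | j ≤ k}, ∀ l ∉ {k : Fin n | j ≤ k}, P l * T * P k = 0 := by
      intro k hk l hl
      simp only [Set.mem_ofPred_eq, Fin.le_def] at hk hl
      by_cases hkl : 1 < |(l : ℤ) - (k : ℤ)|
      · exact h.mul_eq_zero l k hkl
      · rw [not_lt, abs_le] at hkl
        obtain rfl : l = i := by ext; omega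
        obtain rfl : k = j := by ext; omega
        exact h0
    rcases h.complete.eq_zero_or_eq_zero h.irreducible _ hS with h1 | h1
    · exact hj (h1 j (by simp))
    · exact hi (h1 i (by simp only [Set.mem_ofPred_eq, Fin.le_def]; omega))

theorem ordConnected_support (h : IsIrreducibleTridiagonal T P) :
    Set.OrdConnected {i | P i ≠ 0} := by
  refine ⟨fun i hi k hk j hj hj0 => ?_⟩
  have hij : i < j := lt_of_le_of_ne hj.1 fun e => hi (e ▸ hj0)
  have hjk : j < k := lt_of_le_of_ne hj.2 fun e => hk (e ▸ hj0)
  have hS : ∀ l ∈ {l : Fin n | l < j}, ∀ m ∉ {l : Fin n | l < j}, P m * T * P l = 0 := by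
    intro l hl m hm
    simp only [Set.mem_ofPred_eq, Fin.lt_def, not_lt] at hl hm
    by_cases hlm : 1 < |(m : ℤ) - (l : ℤ)|
    · exact h.mul_eq_zero m l hlm
    · rw [not_lt, abs_le] at hlm
      obtain rfl : m = j := by ext; omega
      simp [hj0]
  rcases h.complete.eq_zero_or_eq_zero h.irreducible _ hS with h1 | h1
  · exact hi (h1 i hij)
  · exact hk (h1 k (not_lt.2 hjk.le))

/-- When the blocks have size at most one, an eigenvector of `T` whose first component vanishes is
zero: the tridiagonal recurrence determines all components from the first one. -/
theorem eq_zero_of_first_eq_zero (h : IsIrreducibleTridiagonal T P) [FiniteDimensional ℂ V]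
    (h1 : ∀ i, Module.finrank ℂ (LinearMap.range (P i)) ≤ 1) {r : Fin n}
    (hr : P r ≠ 0) (hmin : ∀ i < r, P i = 0) {c : ℂ} {v : V} (hv : T v = c • v)
    (hrv : P r v = 0) : v = 0 := by
  have key : ∀ k, P k v = 0 := by
    intro k
    induction k using WellFoundedLT.induction with
    | _ k ih =>
    by_cases hk0 : P k = 0
    · simp [hk0]
    by_contra hkv
    have hrk : r < k := by
      rcases lt_trichotomy k r with hlt | rfl | hlt
      · exact absurd (hmin k hlt) hk0
      · exact absurd hrv hkv
      · exact hlt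
    let l : Fin n := ⟨(k : ℕ) - 1, by omega⟩
    have hlk : (l : ℕ) + 1 = k := by simp only [l]; rw [Fin.lt_def] at hrk; omega
    have hl0 : P l ≠ 0 := h.ordConnected_support.out hr hk0
      ⟨by rw [Fin.le_def]; rw [Fin.lt_def] at hrk; omega, by rw [Fin.le_def]; omega⟩
    -- Compare the components of `T v = c v` at the index `l = k - 1`.
    have hlT : P l (T (P k v)) = 0 := by
      have e : P l (T v) = ∑ i, P l (T (P i v)) := by
        conv_lhs => rw [← h.complete.sum_apply v]
        rw [map_sum, map_sum]
      rw [hv, map_smul, ih l (by rw [Fin.lt_def]; omega), smul_zero,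
        Finset.sum_eq_single k] at e
      · exact e.symm
      · intro i _ hik
        rcases lt_or_gt_of_ne hik with hlt | hlt
        · simp [ih i hlt]
        · refine congrArg (fun f : Module.End ℂ V => f v) (h.mul_eq_zero l i ?_)
          rw [Fin.lt_def] at hlt
          rw [lt_abs]
          omega
      · simp
    refine h.mul_ne_zero hl0 hk0 (by rw [abs_eq zero_le_one]; omega) ?_
    ext w
    have hspan := finrank_le_one_iff.1 (h1 k)
    obtain ⟨z, hz⟩ := hspan
    obtain ⟨s, hs⟩ := hz ⟨P k v, v, rfl⟩
    obtain ⟨t, ht⟩ := hz ⟨P k w, w, rfl⟩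
    have hs' : s • (z : V) = P k v := congrArg Subtype.val hs
    have ht' : t • (z : V) = P k w := congrArg Subtype.val ht
    have hs0 : s ≠ 0 := by
      rintro rfl
      exact hkv (by rw [← hs', zero_smul])
    have hz' : (z : V) = s⁻¹ • P k v := by rw [← hs', smul_smul, inv_mul_cancel₀ hs0, one_smul]
    change P l (T (P k w)) = 0
    rw [← ht', hz', map_smul, map_smul, map_smul, map_smul, hlT, smul_zero, smul_zero]
  rw [← h.complete.sum_apply v]
  exact Finset.sum_eq_zero fun i _ => key i

/-- Thinness passes from `P` to the eigenspaces of `T`. -/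
theorem finrank_range_le_one (h : IsIrreducibleTridiagonal T P) [FiniteDimensional ℂ V]
    (h1 : ∀ i, Module.finrank ℂ (LinearMap.range (P i)) ≤ 1) {Q : Module.End ℂ V} {c : ℂ}
    (hQ : T * Q = c • Q) : Module.finrank ℂ (LinearMap.range Q) ≤ 1 := by
  classical
  by_cases hne : ∃ i, P i ≠ 0
  · obtain ⟨r, hr, hmin⟩ := WellFounded.has_min (wellFounded_lt (α := Fin n)) {i | P i ≠ 0} hne
    refine le_trans ?_ (h1 r)
    refine LinearMap.finrank_le_finrank_of_injective
      (f := ((P r).rangeRestrict).comp (LinearMap.range Q).subtype) ?_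
    rw [← LinearMap.ker_eq_bot, LinearMap.ker_eq_bot']
    rintro ⟨v, u, rfl⟩ hv
    have hv' : P r (Q u) = 0 := congrArg Subtype.val hv
    refine Subtype.ext (h.eq_zero_of_first_eq_zero h1 hr (fun i hi => ?_) (c := c) ?_ hv')
    · by_contra h0
      exact hmin i h0 hi
    · exact congrArg (fun f : Module.End ℂ V => f u) hQ
  · push Not at hne
    have hV : ∀ v : V, v = 0 := fun v => by
      rw [← h.complete.sum_apply v]
      exact Finset.sum_eq_zero fun i _ => by simp [hne i]
    have : Subsingleton V := ⟨fun v w => by rw [hV v, hV w]⟩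
    simp [Module.finrank_zero_of_subsingleton]

end IsIrreducibleTridiagonal

end Tridiagonal

/-- A nonempty order-connected set of indices is the interval determined by its least element and
its cardinality. -/
theorem Set.OrdConnected.mem_iff_of_fin {n : ℕ} {S : Set (Fin n)} (hS : S.OrdConnected)
    (hne : S.Nonempty) {r d : ℕ} (hr : r = sInf {i : ℕ | ∃ j : Fin n, (j : ℕ) = i ∧ j ∈ S})
    (hd : S.ncard = d + 1) : r + d < n ∧ ∀ i : Fin n, i ∈ S ↔ r ≤ i ∧ (i : ℕ) ≤ r + d := by
  classical
  obtain ⟨m, hm, hmin⟩ := S.toFinite.exists_minimal hne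
  obtain ⟨M, hM, hmax⟩ := S.toFinite.exists_maximal hne
  have hSe : S = Set.Icc m M := by
    refine Set.Subset.antisymm (fun i hi => ⟨?_, ?_⟩) (hS.out hm hM)
    · exact (le_total m i).elim id (hmin hi)
    · exact (le_total i M).elim id (hmax hi)
  have hrm : r = m := by
    rw [hr]
    refine le_antisymm (Nat.sInf_le ⟨m, rfl, hm⟩) (le_csInf ⟨m, m, rfl, hm⟩ ?_)
    rintro _ ⟨j, rfl, hj⟩
    rw [hSe] at hj
    exact hj.1
  have hmM : (m : ℕ) ≤ M := (hSe ▸ hm : m ∈ Set.Icc m M).2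
  have hcard : (M : ℕ) + 1 - m = d + 1 := by
    rw [← hd, hSe, ← Finset.coe_Icc, Set.ncard_coe_finset, Fin.card_Icc]
  refine ⟨by have := M.2; omega, fun i => ?_⟩
  rw [hSe, Set.mem_Icc, Fin.le_def, Fin.le_def]
  omega

/-! ### Primitive idempotents of a diagonalizable map -/

section Leonard

variable {V : Type*} [AddCommGroup V] [Module ℂ V]

/-- A complete system of orthogonal idempotents onto eigenspaces with distinct eigenvalues consists
of primitive idempotents. -/
theorem isEigenvalueSequence_of_mul_eq_smul {d : ℕ} {A : Module.End ℂ V}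
    {P : Fin (d + 1) → Module.End ℂ V} (hP : CompleteOrthogonalIdempotents P)
    (hne : ∀ i, P i ≠ 0) {φ : Fin (d + 1) → ℂ} (hφ : Function.Injective φ)
    (hA : ∀ i, A * P i = φ i • P i) : IsEigenvalueSequence A P φ := by
  have hAP : ∀ i v, A (P i v) = φ i • P i v := fun i v =>
    congrArg (fun f : Module.End ℂ V => f v) (hA i)
  have hmul : ∀ i j, i ≠ j → ∀ v, P i (P j v) = 0 := fun i j hij v =>
    congrArg (fun f : Module.End ℂ V => f v) (hP.ortho hij)
  have hid : ∀ i v, P i (P i v) = P i v := fun i v =>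
    congrArg (fun f : Module.End ℂ V => f v) (hP.idem i).eq
  -- Each `P i` kills the eigenvectors for eigenvalues other than `φ i`.
  have hkill : ∀ i ν, ν ≠ φ i → ∀ v ∈ A.eigenspace ν, P i v = 0 := by
    intro i ν hν v hv
    rw [Module.End.mem_eigenspace_iff] at hv
    have e : P i (A v) = φ i • P i v := by
      conv_lhs => rw [← hP.sum_apply v]
      rw [map_sum, map_sum, Finset.sum_eq_single i]
      · rw [hAP, map_smul, hid]
      · intro j _ hj
        rw [hAP, map_smul, hmul i j hj.symm, smul_zero]
      · simp
    rw [hv, map_smul, ← sub_eq_zero, ← sub_smul] at e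
    exact (smul_eq_zero.1 e).resolve_left (sub_ne_zero.2 hν)
  intro i
  refine ⟨?_, fun v hv => ?_, fun ν hν v hv => hkill i ν hν v hv⟩
  · obtain ⟨v, hv⟩ : ∃ v, P i v ≠ 0 := by
      by_contra! h0
      exact hne i (LinearMap.ext h0)
    exact Module.End.hasEigenvalue_of_hasEigenvector
      ⟨Module.End.mem_eigenspace_iff.2 (hAP i v), hv⟩
  · conv_rhs => rw [← hP.sum_apply v]
    rw [Finset.sum_eq_single i (fun j _ hj => hkill j _ (fun e => hj (hφ e.symm)) v hv) (by simp)]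

theorem IsEigenvalueSequence.range_eq {d : ℕ} {A : Module.End ℂ V}
    {P : Fin (d + 1) → Module.End ℂ V} (hP : CompleteOrthogonalIdempotents P)
    {φ : Fin (d + 1) → ℂ} (h : IsEigenvalueSequence A P φ) :
    {μ : ℂ | A.HasEigenvalue μ} = Set.range φ := by
  ext μ
  refine ⟨fun hμ => ?_, ?_⟩
  · by_contra hn
    obtain ⟨v, hv, hv0⟩ := hμ.exists_hasEigenvector
    refine hv0 ?_
    rw [← hP.sum_apply v]
    exact Finset.sum_eq_zero fun i _ => (h i).2.2 μ (fun e => hn ⟨i, e.symm⟩) v hv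
  · rintro ⟨i, rfl⟩
    exact (h i).1

theorem IsEigenvalueSequence.isMultiplicityFree {d : ℕ} {A : Module.End ℂ V}
    {P : Fin (d + 1) → Module.End ℂ V} (hP : CompleteOrthogonalIdempotents P)
    (hdim : Module.finrank ℂ V = d + 1)
    {φ : Fin (d + 1) → ℂ} (hφ : Function.Injective φ)
    (h : IsEigenvalueSequence A P φ) : IsMultiplicityFree A := by
  rw [IsMultiplicityFree, h.range_eq hP, hdim, ← Set.image_univ,
    Set.ncard_image_of_injective _ hφ, Set.ncard_univ, Nat.card_eq_fintype_card, Fintype.card_fin]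

theorem IsEigenvalueSequence.isPrimitiveIdempotentOrdering {d : ℕ} {A : Module.End ℂ V}
    {P : Fin (d + 1) → Module.End ℂ V} (hP : CompleteOrthogonalIdempotents P)
    (hne : ∀ i, P i ≠ 0) {φ : Fin (d + 1) → ℂ}
    (hA : ∀ i, A * P i = φ i • P i) (h : IsEigenvalueSequence A P φ) :
    IsPrimitiveIdempotentOrdering A P := by
  refine ⟨fun i j hij => ?_, ?_⟩
  · by_contra hne'
    have : P i * P j = 0 := hP.ortho hne'
    rw [← hij, (hP.idem i).eq] at this
    exact hne i this
  · ext F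
    refine ⟨?_, ?_⟩
    · rintro ⟨i, rfl⟩
      exact ⟨φ i, h i⟩
    · rintro ⟨μ, hμ, hF1, hF0⟩
      obtain ⟨i, rfl⟩ : μ ∈ Set.range φ := by rw [← h.range_eq hP]; exact hμ
      refine ⟨i, ?_⟩
      -- Both maps agree on the eigenspaces, which span.
      have hmem : ∀ j v, P j v ∈ A.eigenspace (φ j) := fun j v =>
        Module.End.mem_eigenspace_iff.2 (congrArg (fun f : Module.End ℂ V => f v) (hA j))
      ext v
      rw [← hP.sum_apply v, map_sum, map_sum]
      refine Finset.sum_congr rfl fun j _ => ?_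
      by_cases hj : φ j = φ i
      · rw [(h i).2.1 _ (hj ▸ hmem j v), hF1 _ (hj ▸ hmem j v)]
      · rw [(h i).2.2 _ hj _ (hmem j v), hF0 _ hj _ (hmem j v)]

/-- The nonzero members of a complete system of orthogonal idempotents, when they are the ones
with index in `[r, r + d]`, form a complete system. -/
theorem CompleteOrthogonalIdempotents.interval {R : Type*} [Ring R] {n r d : ℕ} {P : Fin n → R}
    (hP : CompleteOrthogonalIdempotents P) (hrd : r + d < n)
    (hsupp : ∀ i : Fin n, P i ≠ 0 ↔ r ≤ i ∧ (i : ℕ) ≤ r + d) :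
    CompleteOrthogonalIdempotents fun i : Fin (d + 1) => P ⟨r + i, by omega⟩ := by
  have hinj : Function.Injective fun i : Fin (d + 1) => (⟨r + i, by omega⟩ : Fin n) := by
    intro i j hij
    simpa [Fin.ext_iff] using hij
  refine ⟨⟨fun i => hP.idem _, fun i j hij => hP.ortho (hinj.ne hij)⟩, ?_⟩
  rw [← hP.complete]
  refine Fintype.sum_of_injective _ hinj _ _ (fun i hi => ?_) fun i => rfl
  by_contra h0
  obtain ⟨h1, h2⟩ := (hsupp i).1 h0
  exact hi ⟨⟨i - r, by omega⟩, by ext; simp; omega⟩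

end Leonard

/-! ### Distances and the adjacency matrix -/

section Distance

variable {X : Type*} {G : SimpleGraph X}

theorem transpose_distanceMatrix (G : SimpleGraph X) (i : ℕ) :
    (distanceMatrix G i)ᵀ = distanceMatrix G i := by
  ext y z
  simp [distanceMatrix, SimpleGraph.dist_comm]

theorem conjTranspose_distanceMatrix (G : SimpleGraph X) (i : ℕ) :
    (distanceMatrix G i)ᴴ = distanceMatrix G i := by
  ext y z
  simp [distanceMatrix, SimpleGraph.dist_comm, Matrix.conjTranspose_apply, apply_ite]

theorem distanceMatrix_one_eq_adjMatrix [DecidableRel G.Adj] :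
    distanceMatrix G 1 = G.adjMatrix ℂ := by
  ext y z
  simp [distanceMatrix, SimpleGraph.adjMatrix_apply, SimpleGraph.dist_eq_one_iff_adj]

theorem dist_lt_diam_add_one [Finite X] (hG : G.Connected) (x y : X) : G.dist x y < G.diam + 1 := by
  have : Nonempty X := ⟨x⟩
  exact Nat.lt_succ_of_le
    (SimpleGraph.dist_le_diam (SimpleGraph.connected_iff_ediam_ne_top.1 hG))

end Distance

/-! ### Primitive idempotents and Krein parameters of the graph -/

section Graph

variable {X : Type*} [Fintype X] [DecidableEq X] {G : SimpleGraph X}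

theorem distanceMatrix_mem_boseMesner (G : SimpleGraph X) : distanceMatrix G 1 ∈ boseMesner G :=
  Algebra.subset_adjoin rfl

theorem commute_of_mem_boseMesner {Y Z : Matrix X X ℂ} (hY : Y ∈ boseMesner G)
    (hZ : Z ∈ boseMesner G) : Y * Z = Z * Y := by
  rw [boseMesner, Algebra.adjoin_singleton_eq_range_aeval] at hY hZ
  obtain ⟨p, rfl⟩ := hY
  obtain ⟨r, rfl⟩ := hZ
  change Polynomial.aeval _ p * Polynomial.aeval _ r = Polynomial.aeval _ r * Polynomial.aeval _ p
  rw [← map_mul, ← map_mul, mul_comm]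

theorem transpose_of_mem_boseMesner {Y : Matrix X X ℂ} (hY : Y ∈ boseMesner G) : Yᵀ = Y := by
  induction hY using Algebra.adjoin_induction with
  | mem Y hY => rw [Set.mem_singleton_iff.1 hY, transpose_distanceMatrix]
  | algebraMap c => simp [Matrix.algebraMap_eq_diagonal]
  | add Y Z _ _ hY hZ => rw [Matrix.transpose_add, hY, hZ]
  | mul Y Z hY' hZ' hY hZ =>
    rw [Matrix.transpose_mul, hY, hZ]
    exact commute_of_mem_boseMesner hZ' hY'

theorem conjTranspose_mem_boseMesner {Y : Matrix X X ℂ} (hY : Y ∈ boseMesner G) :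
    Yᴴ ∈ boseMesner G := by
  have h : star (boseMesner G) = boseMesner G := by
    rw [boseMesner, Subalgebra.star_adjoin_comm, Set.star_singleton, Matrix.star_eq_conjTranspose,
      conjTranspose_distanceMatrix]
  rw [← Matrix.star_eq_conjTranspose, ← Subalgebra.mem_star_iff, h]
  exact hY

namespace IsPrimitiveIdempotents

variable {E : Fin (G.diam + 1) → Matrix X X ℂ}

theorem mem_boseMesner (hE : IsPrimitiveIdempotents G E) (i : Fin (G.diam + 1)) :
    E i ∈ boseMesner G := by
  rw [← Subalgebra.mem_toSubmodule, ← hE.span_eq]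
  exact Submodule.subset_span ⟨i, rfl⟩

theorem complete (hE : IsPrimitiveIdempotents G E) : CompleteOrthogonalIdempotents E :=
  ⟨⟨fun i => by rw [IsIdempotentElem, hE.mul_eq, if_pos rfl],
    fun i j hij => (hE.mul_eq i j).trans (if_neg hij)⟩, hE.sum_eq⟩

theorem transpose_eq (hE : IsPrimitiveIdempotents G E) (i : Fin (G.diam + 1)) : (E i)ᵀ = E i :=
  transpose_of_mem_boseMesner (hE.mem_boseMesner i)

theorem apply_comm (hE : IsPrimitiveIdempotents G E) (i : Fin (G.diam + 1)) (y z : X) :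
    E i y z = E i z y :=
  congrFun (congrFun (hE.transpose_eq i) z) y

open scoped ComplexOrder in
/-- The conjugate transpose of `E i` lies in the Bose-Mesner algebra, so `(E i)ᴴ * E i` is a nonzero
multiple of `E i`; hence `E i` is a multiple of its conjugate transpose, and idempotency makes the
factor one. -/
theorem conjTranspose_eq (hE : IsPrimitiveIdempotents G E) (i : Fin (G.diam + 1)) :
    (E i)ᴴ = E i := by
  have hne : E i ≠ 0 := hE.linearIndependent.ne_zero i
  have hmem := conjTranspose_mem_boseMesner (hE.mem_boseMesner i)
  rw [← Subalgebra.mem_toSubmodule, ← hE.span_eq, Submodule.mem_span_range_iff_exists_fun] at hmem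
  obtain ⟨c, hc⟩ := hmem
  have h1 : (E i)ᴴ * E i = c i • E i := by
    rw [← hc, hE.complete.sum_smul_mul]
  have hc0 : c i ≠ 0 := by
    intro h0
    rw [h0, zero_smul, Matrix.conjTranspose_mul_self_eq_zero] at h1
    exact hne h1
  have h2 : c i • E i = star (c i) • (E i)ᴴ := by
    rw [← Matrix.conjTranspose_smul, ← h1, Matrix.conjTranspose_mul,
      Matrix.conjTranspose_conjTranspose]
  have hs : star (c i) ≠ 0 := star_ne_zero.2 hc0
  have h3 : (E i)ᴴ = ((star (c i))⁻¹ * c i) • E i := by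
    rw [mul_smul, h2, smul_smul, inv_mul_cancel₀ hs, one_smul]
  set s := (star (c i))⁻¹ * c i with hsdef
  have hs0 : s ≠ 0 := mul_ne_zero (inv_ne_zero hs) hc0
  have h4 : (E i)ᴴ * (E i)ᴴ = (E i)ᴴ := by
    rw [← Matrix.conjTranspose_mul, (hE.complete.idem i).eq]
  rw [h3, smul_mul_smul_comm, (hE.complete.idem i).eq] at h4
  have h5 : s * s = s := smul_left_injective ℂ hne h4
  have h6 : s = 1 := mul_left_cancel₀ hs0 (by rw [h5, mul_one])
  rw [h3, h6, one_smul]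

open scoped ComplexOrder in
theorem trace_ne_zero (hE : IsPrimitiveIdempotents G E) (i : Fin (G.diam + 1)) :
    (E i).trace ≠ 0 := by
  intro h
  rw [← (hE.complete.idem i).eq] at h
  nth_rewrite 1 [← hE.conjTranspose_eq i] at h
  rw [Matrix.trace_conjTranspose_mul_self_eq_zero_iff] at h
  exact hE.linearIndependent.ne_zero i h

/-- The adjacency matrix generates the `D + 1`-dimensional Bose-Mesner algebra, so its eigenvalues
are distinct. -/
theorem eigenvalue_injective (hE : IsPrimitiveIdempotents G E) {θ : Fin (G.diam + 1) → ℂ}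
    (hθ : distanceMatrix G 1 = ∑ i, θ i • E i) : Function.Injective θ := by
  intro i j hij
  by_contra hne
  have hmem := hE.mem_boseMesner i
  rw [boseMesner, Algebra.adjoin_singleton_eq_range_aeval] at hmem
  obtain ⟨p, hp⟩ := hmem
  replace hp : Polynomial.aeval (distanceMatrix G 1) p = E i := hp
  have hi := aeval_mul_of_mul_eq_smul (hθ ▸ hE.complete.sum_smul_mul θ i) p
  have hj := aeval_mul_of_mul_eq_smul (hθ ▸ hE.complete.sum_smul_mul θ j) p
  rw [hp, (hE.complete.idem i).eq] at hi
  rw [hp, hE.complete.ortho hne, ← hij] at hj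
  rcases smul_eq_zero.1 hj.symm with h | h
  · rw [h, zero_smul] at hi
    exact hE.linearIndependent.ne_zero i hi
  · exact hE.linearIndependent.ne_zero j h

variable {κ : Fin (G.diam + 1) → Fin (G.diam + 1) → Fin (G.diam + 1) → ℂ}

theorem card_ne_zero (hE : IsPrimitiveIdempotents G E) : (Fintype.card X : ℂ) ≠ 0 := by
  intro h
  have := hE.zero_eq
  rw [h, inv_zero, zero_smul] at this
  exact hE.linearIndependent.ne_zero 0 this

/-- The sum of the entries of `E i ⊙ E j ⊙ E h`, expressed by a Krein parameter. -/
theorem sum_hadamard_apply (hE : IsPrimitiveIdempotents G E) (hκ : IsKreinParameters G E κ)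
    (i j h : Fin (G.diam + 1)) :
    ∑ y, ∑ z, E i y z * E j y z * E h y z =
      (Fintype.card X : ℂ)⁻¹ * (κ i j h * (E h).trace) := by
  have h1 := Matrix.sum_hadamard_eq (A := E i ⊙ E j) (B := E h)
  simp only [Matrix.hadamard_apply] at h1
  rw [h1, hE.transpose_eq, hκ i j, smul_mul_assoc, hE.complete.sum_smul_mul, Matrix.trace_smul,
    Matrix.trace_smul, smul_eq_mul, smul_eq_mul]

/-- Cyclic symmetry of the Krein parameters, up to multiplicities. -/
theorem krein_mul_trace (hE : IsPrimitiveIdempotents G E) (hκ : IsKreinParameters G E κ)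
    (i j h : Fin (G.diam + 1)) : κ i j h * (E h).trace = κ j h i * (E i).trace := by
  have h1 := hE.sum_hadamard_apply hκ i j h
  have h2 := hE.sum_hadamard_apply hκ j h i
  have h3 : ∑ y, ∑ z, E i y z * E j y z * E h y z = ∑ y, ∑ z, E j y z * E h y z * E i y z :=
    Finset.sum_congr rfl fun y _ => Finset.sum_congr rfl fun z _ => by ring
  rw [h3, h2] at h1
  exact (mul_left_cancel₀ (inv_ne_zero hE.card_ne_zero) h1).symm

open scoped ComplexOrder in
/-- For the dual adjacency matrix `B`, the squared Frobenius norm of `E i * B * E j` is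
`|X| κ i j 1 (E 1)ₓₓ`, so this matrix vanishes together with the Krein parameter `κ i j 1`. -/
theorem mul_dualAdjacency_mul_eq_zero (hE : IsPrimitiveIdempotents G E)
    (hκ : IsKreinParameters G E κ) (x : X) {i j : Fin (G.diam + 1)} (h0 : κ i j 1 = 0) :
    E i * dualAdjacency G E x * E j = 0 := by
  rw [← Matrix.trace_mul_conjTranspose_self_eq_zero_iff]
  have hstar : (dualAdjacency G E x)ᴴ = dualAdjacency G E x := by
    rw [dualAdjacency, Matrix.diagonal_conjTranspose]
    congr 1
    funext y
    have h1 : star (E 1 x y) = E 1 y x := congrFun (congrFun (hE.conjTranspose_eq 1) y) x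
    simp only [Pi.star_apply, star_mul', h1, hE.apply_comm 1 y x]
    simp
  have h1 : E i * dualAdjacency G E x * E j * (E i * dualAdjacency G E x * E j)ᴴ =
      E i * (dualAdjacency G E x * E j * dualAdjacency G E x * E i) := by
    rw [Matrix.conjTranspose_mul, Matrix.conjTranspose_mul, hE.conjTranspose_eq,
      hE.conjTranspose_eq, hstar]
    simp only [mul_assoc]
    rw [← mul_assoc (E j) (E j), (hE.complete.idem j).eq]
  have h2 : (E 1 * (E i ⊙ E j) * E 1) x x = 0 := by
    rw [hκ i j, mul_smul_comm, smul_mul_assoc, mul_assoc, hE.complete.sum_smul_mul, h0, zero_smul,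
      mul_zero, smul_zero, Matrix.zero_apply]
  rw [h1, Matrix.trace_mul_comm, mul_assoc, (hE.complete.idem i).eq]
  calc (dualAdjacency G E x * E j * dualAdjacency G E x * E i).trace
      = (Fintype.card X : ℂ) ^ 2 * (E 1 * (E i ⊙ E j) * E 1) x x := by
        simp only [Matrix.trace, Matrix.diag_apply, Matrix.mul_apply (M := _ * _) (N := E i),
          dualAdjacency, Matrix.mul_diagonal, Matrix.diagonal_mul, Matrix.mul_apply (N := E 1),
          Matrix.mul_apply (M := E 1), Finset.sum_mul, Finset.mul_sum, Matrix.hadamard_apply]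
        rw [Finset.sum_comm]
        refine Finset.sum_congr rfl fun y _ => Finset.sum_congr rfl fun z _ => ?_
        rw [hE.apply_comm i y z, hE.apply_comm 1 y x]
        ring
    _ = 0 := by rw [h2, mul_zero]

/-- In the `Q`-polynomial case `E 1` generates the Bose-Mesner algebra under the entrywise product.
Hence the entries of all `E h` agree at two positions at which the entries of `E 1` agree. -/
theorem apply_eq_of_apply_one_eq (hE : IsPrimitiveIdempotents G E) (hQ : IsQPolynomial G E)
    {x y z : X} (h1 : E 1 x y = E 1 x z) (h : Fin (G.diam + 1)) : E h x y = E h x z := by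
  obtain ⟨κ, hκ, hκQ⟩ := hQ
  have hzero : ∀ j h : Fin (G.diam + 1), (j : ℕ) + 1 < h → κ 1 j h = 0 := by
    intro j h hjh
    have e := hE.krein_mul_trace hκ 1 j h
    rw [(hκQ j h).1 (by rw [lt_abs]; omega), zero_mul] at e
    exact (mul_eq_zero.1 e).resolve_right (hE.trace_ne_zero h)
  have hnonzero : ∀ j h : Fin (G.diam + 1), (j : ℕ) + 1 = h → κ 1 j h ≠ 0 := by
    intro j h hjh h0
    have e := hE.krein_mul_trace hκ 1 j h
    rw [h0, zero_mul] at e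
    exact (hκQ j h).2 (by rw [abs_eq zero_le_one]; omega)
      ((mul_eq_zero.1 e.symm).resolve_right (hE.trace_ne_zero 1))
  induction h using WellFoundedLT.induction with
  | _ h ih =>
  by_cases hh : (h : ℕ) = 0
  · obtain rfl : h = 0 := Fin.ext hh
    simp [hE.zero_eq]
  · let j : Fin (G.diam + 1) := ⟨(h : ℕ) - 1, by omega⟩
    have hj : (j : ℕ) + 1 = h := by simp only [j]; omega
    -- Compare both entries of `E 1 ⊙ E j`, whose last component is that of `E h`.
    have e : ∀ t, (Fintype.card X : ℂ) * (E 1 x t * E j x t) = ∑ l, κ 1 j l * E l x t := by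
      intro t
      have e1 := congrFun (congrFun (hκ 1 j) x) t
      rw [Matrix.hadamard_apply, Matrix.smul_apply, Matrix.sum_apply] at e1
      simp only [Matrix.smul_apply, smul_eq_mul] at e1
      rw [e1, ← mul_assoc, mul_inv_cancel₀ hE.card_ne_zero, one_mul]
    have e2 : ∑ l, κ 1 j l * E l x y = ∑ l, κ 1 j l * E l x z := by
      rw [← e y, ← e z, h1, ih j (by rw [Fin.lt_def]; omega)]
    rw [← sub_eq_zero, ← Finset.sum_sub_distrib, Finset.sum_eq_single h] at e2
    · rw [← mul_sub] at e2
      exact sub_eq_zero.1 ((mul_eq_zero.1 e2).resolve_left (hnonzero j h hj))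
    · intro l _ hl
      rcases lt_or_gt_of_ne hl with hlt | hlt
      · rw [ih l hlt, sub_self]
      · rw [hzero j l (by rw [hj]; exact hlt), zero_mul, zero_mul, sub_self]
    · simp

end IsPrimitiveIdempotents

/-- Powers of the adjacency matrix count walks, so the Bose-Mesner algebra separates vertices at
different distances from `x`. -/
theorem exists_mem_boseMesner_apply_ne (hG : G.Connected) {x y z : X}
    (hyz : G.dist x y ≠ G.dist x z) : ∃ Y ∈ boseMesner G, Y x y ≠ Y x z := by
  classical
  wlog hlt : G.dist x y < G.dist x z generalizing y z
  · obtain ⟨Y, hY, hne⟩ := this hyz.symm (lt_of_le_of_ne (not_lt.1 hlt) hyz.symm)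
    exact ⟨Y, hY, hne.symm⟩
  refine ⟨distanceMatrix G 1 ^ G.dist x y, pow_mem (distanceMatrix_mem_boseMesner G) _, ?_⟩
  rw [distanceMatrix_one_eq_adjMatrix, SimpleGraph.adjMatrix_pow_apply_eq_card_walk,
    SimpleGraph.adjMatrix_pow_apply_eq_card_walk]
  have hz : Fintype.card {p : G.Walk x z | p.length = G.dist x y} = 0 := by
    rw [Fintype.card_eq_zero_iff]
    refine ⟨fun p => ?_⟩
    have h1 := SimpleGraph.dist_le p.1
    have h2 : p.1.length = G.dist x y := p.2
    omega
  have hy : Fintype.card {p : G.Walk x y | p.length = G.dist x y} ≠ 0 := by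
    obtain ⟨p, hp⟩ := hG.exists_walk_length_eq_dist x y
    exact (Fintype.card_pos_iff.2 ⟨⟨p, hp⟩⟩).ne'
  rw [hz, Nat.cast_zero]
  exact Nat.cast_ne_zero.2 hy

/-! ### Dual idempotents -/

theorem complete_dualIdempotent (hG : G.Connected) (x : X) :
    CompleteOrthogonalIdempotents (dualIdempotent G x) := by
  refine ⟨⟨fun i => ?_, fun i j hij => ?_⟩, ?_⟩
  · rw [IsIdempotentElem, dualIdempotent, Matrix.diagonal_mul_diagonal]
    simp
  · simp only [dualIdempotent, Matrix.diagonal_mul_diagonal]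
    rw [Matrix.diagonal_eq_zero]
    funext y
    by_cases h : G.dist x y = i
    · have : (i : ℕ) ≠ j := fun e => hij (Fin.ext e)
      simp [h, this]
    · simp [h]
  · ext y z
    simp only [dualIdempotent, Matrix.sum_apply, Matrix.diagonal_apply, Matrix.one_apply]
    by_cases h : y = z
    · subst h
      simp only [if_true]
      rw [Finset.sum_eq_single ⟨G.dist x y, dist_lt_diam_add_one hG x y⟩]
      · simp
      · intro i _ hi
        rw [if_neg fun e => hi (Fin.ext e.symm)]
      · simp
    · simp [h]

/-- Adjacent vertices have distances from `x` differing by at most one. -/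
theorem dualIdempotent_mul_distanceMatrix_mul_eq_zero (hG : G.Connected) (x : X)
    {i j : Fin (G.diam + 1)} (hij : 1 < |(i : ℤ) - (j : ℤ)|) :
    dualIdempotent G x i * distanceMatrix G 1 * dualIdempotent G x j = 0 := by
  ext y z
  simp only [dualIdempotent, Matrix.mul_diagonal, Matrix.diagonal_mul, distanceMatrix,
    Matrix.of_apply, Matrix.zero_apply, mul_ite, mul_one, mul_zero]
  by_contra h
  have hz : G.dist x z = j := by by_contra h'; simp [h'] at h
  have hyz : G.dist y z = 1 := by by_contra h'; simp [h'] at h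
  have hy : G.dist x y = i := by by_contra h'; simp [h'] at h
  have h1 := hG.dist_triangle (u := x) (v := y) (w := z)
  have h2 := hG.dist_triangle (u := x) (v := z) (w := y)
  rw [SimpleGraph.dist_comm (u := z)] at h2
  rw [lt_abs] at hij
  omega

theorem exists_dist_eq_of_dualIdempotent_ne_zero {x : X} {i : Fin (G.diam + 1)}
    (h : dualIdempotent G x i ≠ 0) : ∃ y, G.dist x y = i := by
  by_contra! hn
  refine h ?_
  rw [dualIdempotent, Matrix.diagonal_eq_zero]
  funext y
  simp [hn y]

/-- The dual eigenvalues are distinct at the distances that occur. -/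
theorem injOn_dualEigenvalue (hG : G.Connected) {E : Fin (G.diam + 1) → Matrix X X ℂ}
    (hE : IsPrimitiveIdempotents G E) (hQ : IsQPolynomial G E) {x : X}
    {θs : Fin (G.diam + 1) → ℂ}
    (hθs : dualAdjacency G E x = ∑ i, θs i • dualIdempotent G x i) :
    Set.InjOn θs {i | dualIdempotent G x i ≠ 0} := by
  have hval : ∀ (i : Fin (G.diam + 1)) (y : X), G.dist x y = i →
      (Fintype.card X : ℂ) * E 1 x y = θs i := by
    intro i y hy
    have e := congrFun (congrFun hθs y) y
    simp only [dualAdjacency, Matrix.diagonal_apply_eq, Matrix.sum_apply, Matrix.smul_apply,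
      dualIdempotent, smul_eq_mul] at e
    rw [e, Finset.sum_eq_single i]
    · simp [hy]
    · intro j _ hj
      have : (i : ℕ) ≠ j := fun e => hj (Fin.ext e.symm)
      simp [hy, this]
    · simp
  intro i hi j hj hij
  by_contra hne
  obtain ⟨y, hy⟩ := exists_dist_eq_of_dualIdempotent_ne_zero hi
  obtain ⟨z, hz⟩ := exists_dist_eq_of_dualIdempotent_ne_zero hj
  have h1 : E 1 x y = E 1 x z :=
    mul_left_cancel₀ hE.card_ne_zero (by rw [hval i y hy, hval j z hz, hij])
  obtain ⟨Y, hY, hYne⟩ := exists_mem_boseMesner_apply_ne hG (x := x) (y := y) (z := z)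
    (by rw [hy, hz]; exact fun e => hne (Fin.ext e))
  rw [← Subalgebra.mem_toSubmodule, ← hE.span_eq, Submodule.mem_span_range_iff_exists_fun] at hY
  obtain ⟨c, rfl⟩ := hY
  refine hYne ?_
  simp only [Matrix.sum_apply, Matrix.smul_apply]
  exact Finset.sum_congr rfl fun h _ => by rw [hE.apply_eq_of_apply_one_eq hQ h1 h]

end Graph

/-! ### The action of the subconstituent algebra on a module -/

section Module

variable {X : Type*} [Fintype X] [DecidableEq X]

/-- The representation of `T` on a `T`-module `W`, as an algebra homomorphism into `End W`. -/
noncomputable def IsTModule.toEnd {T : Subalgebra ℂ (Matrix X X ℂ)} {W : Submodule ℂ (X → ℂ)}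
    (hW : IsTModule T W) : T →ₐ[ℂ] Module.End ℂ W where
  toFun S :=
    { toFun := fun w => ⟨(S : Matrix X X ℂ) *ᵥ (w : X → ℂ), hW S S.2 w w.2⟩
      map_add' := fun v w => Subtype.ext (Matrix.mulVec_add _ _ _)
      map_smul' := fun c w => Subtype.ext (Matrix.mulVec_smul _ _ _) }
  map_one' := by
    ext1 w
    exact Subtype.ext (Matrix.one_mulVec _)
  map_mul' R S := by
    ext1 w
    exact Subtype.ext (Matrix.mulVec_mulVec _ _ _).symm
  map_zero' := by
    ext1 w
    exact Subtype.ext (Matrix.zero_mulVec _)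
  map_add' R S := by
    ext1 w
    exact Subtype.ext (Matrix.add_mulVec _ _ _)
  commutes' c := by
    ext1 w
    refine Subtype.ext ?_
    change (algebraMap ℂ (Matrix X X ℂ) c) *ᵥ (w : X → ℂ) = c • (w : X → ℂ)
    rw [Algebra.algebraMap_eq_smul_one, Matrix.smul_mulVec, Matrix.one_mulVec]

theorem IsTModule.actsOnAs_toEnd {T : Subalgebra ℂ (Matrix X X ℂ)} {W : Submodule ℂ (X → ℂ)}
    (hW : IsTModule T W) (S : T) : ActsOnAs W S (hW.toEnd S) :=
  fun _ => rfl

theorem IsTModule.map_range_toEnd {T : Subalgebra ℂ (Matrix X X ℂ)} {W : Submodule ℂ (X → ℂ)}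
    (hW : IsTModule T W) (S : T) :
    (LinearMap.range (hW.toEnd S)).map W.subtype = matrixImage (S : Matrix X X ℂ) W := by
  ext v
  constructor
  · rintro ⟨_, ⟨w, rfl⟩, rfl⟩
    exact ⟨w, w.2, rfl⟩
  · rintro ⟨w, hw, rfl⟩
    exact ⟨_, ⟨⟨w, hw⟩, rfl⟩, rfl⟩

theorem IsTModule.matrixImage_ne_bot_iff {T : Subalgebra ℂ (Matrix X X ℂ)}
    {W : Submodule ℂ (X → ℂ)} (hW : IsTModule T W) (S : T) :
    matrixImage (S : Matrix X X ℂ) W ≠ ⊥ ↔ hW.toEnd S ≠ 0 := by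
  rw [← hW.map_range_toEnd, Ne, (Submodule.map_injective_of_injective
    W.injective_subtype).eq_iff' (Submodule.map_bot _), LinearMap.range_eq_bot]

theorem IsTModule.finrank_range_toEnd {T : Subalgebra ℂ (Matrix X X ℂ)}
    {W : Submodule ℂ (X → ℂ)} (hW : IsTModule T W) (S : T) :
    Module.finrank ℂ (LinearMap.range (hW.toEnd S)) =
      Module.finrank ℂ (matrixImage (S : Matrix X X ℂ) W) := by
  rw [← hW.map_range_toEnd]
  exact (Submodule.equivMapOfInjective _ W.injective_subtype _).finrank_eq

variable {G : SimpleGraph X} {x : X}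

theorem boseMesner_le_subconstituentAlgebra (G : SimpleGraph X) (x : X) :
    boseMesner G ≤ subconstituentAlgebra G x :=
  le_sup_left

theorem dualIdempotent_mem_subconstituentAlgebra (G : SimpleGraph X) (x : X)
    (i : Fin (G.diam + 1)) : dualIdempotent G x i ∈ subconstituentAlgebra G x :=
  (le_sup_right : dualBoseMesner G x ≤ _) (Algebra.subset_adjoin ⟨i, rfl⟩)

theorem isTModule_of_generators {U : Submodule ℂ (X → ℂ)}
    (hA : ∀ v ∈ U, distanceMatrix G 1 *ᵥ v ∈ U)
    (hP : ∀ i, ∀ v ∈ U, dualIdempotent G x i *ᵥ v ∈ U) :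
    IsTModule (subconstituentAlgebra G x) U := by
  intro S hS
  rw [subconstituentAlgebra, boseMesner, dualBoseMesner, ← Algebra.adjoin_union] at hS
  induction hS using Algebra.adjoin_induction with
  | mem S hS =>
    rcases hS with hS | ⟨i, rfl⟩
    · rw [Set.mem_singleton_iff.1 hS]
      exact hA
    · exact hP i
  | algebraMap c =>
    intro v hv
    rw [Algebra.algebraMap_eq_smul_one, Matrix.smul_mulVec, Matrix.one_mulVec]
    exact U.smul_mem c hv
  | add R S _ _ hR hS =>
    intro v hv
    rw [Matrix.add_mulVec]
    exact U.add_mem (hR v hv) (hS v hv)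
  | mul R S _ _ hR hS =>
    intro v hv
    rw [← Matrix.mulVec_mulVec]
    exact hR _ (hS v hv)

theorem IsIrreducibleTModule.eq_bot_or_eq_top {W : Submodule ℂ (X → ℂ)}
    (hW : IsIrreducibleTModule (subconstituentAlgebra G x) W) {U : Submodule ℂ W}
    (hA : ∀ v ∈ U, hW.1.toEnd ⟨distanceMatrix G 1,
      boseMesner_le_subconstituentAlgebra G x (distanceMatrix_mem_boseMesner G)⟩ v ∈ U)
    (hP : ∀ i, ∀ v ∈ U, hW.1.toEnd ⟨dualIdempotent G x i,
      dualIdempotent_mem_subconstituentAlgebra G x i⟩ v ∈ U) : U = ⊥ ∨ U = ⊤ := by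
  have hT : IsTModule (subconstituentAlgebra G x) (U.map W.subtype) := by
    refine isTModule_of_generators ?_ ?_
    · rintro _ ⟨v, hv, rfl⟩
      exact ⟨_, hA v hv, rfl⟩
    · rintro i _ ⟨v, hv, rfl⟩
      exact ⟨_, hP i v hv, rfl⟩
  rcases hW.2.2 _ hT (Submodule.map_subtype_le W U) with h | h
  · left
    exact ((Submodule.map_injective_of_injective W.injective_subtype).eq_iff'
      (Submodule.map_bot _)).1 h
  · right
    refine Submodule.map_injective_of_injective W.injective_subtype ?_
    rw [h, Submodule.map_top, Submodule.range_subtype]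

end Module

theorem CompleteOrthogonalIdempotents.toEnd {X : Type*} [Fintype X] [DecidableEq X]
    {T : Subalgebra ℂ (Matrix X X ℂ)} {W : Submodule ℂ (X → ℂ)} (hW : IsTModule T W) {ι : Type*}
    [Fintype ι] {F : ι → Matrix X X ℂ} (hF : CompleteOrthogonalIdempotents F)
    (hFT : ∀ i, F i ∈ T) :
    CompleteOrthogonalIdempotents fun i => hW.toEnd ⟨F i, hFT i⟩ := by
  have h : CompleteOrthogonalIdempotents fun i => (⟨F i, hFT i⟩ : T) :=
    ⟨⟨fun i => Subtype.ext (hF.idem i), fun i j hij => Subtype.ext (hF.ortho hij)⟩,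
      Subtype.ext (by simpa using hF.complete)⟩
  exact h.map hW.toEnd.toRingHom

/-! ### Affine normalization and the `q`-Racah sequences -/

theorem mul_affine_mul {R : Type*} [Ring R] [Algebra ℂ R] {P Q T : R} (hPQ : P * Q = 0)
    (c s : ℂ) : P * (c • (T - s • (1 : R))) * Q = c • (P * T * Q) := by
  rw [mul_smul_comm, smul_mul_assoc, mul_sub, sub_mul, mul_smul_comm, mul_one, smul_mul_assoc,
    hPQ, smul_zero, sub_zero]

theorem affine_mul {R : Type*} [Ring R] [Algebra ℂ R] {P T : R} {t : ℂ} (h : T * P = t • P)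
    (c s : ℂ) : (c • (T - s • (1 : R))) * P = (c * (t - s)) • P := by
  rw [smul_mul_assoc, sub_mul, h, smul_mul_assoc, one_mul, ← sub_smul, smul_smul]

/-- The normalized eigenvalues with index in `[r, r + d]` form the `q`-Racah sequence with
parameter `a q ^ (2 r + d - D)`. -/
theorem qRacahSequence_eq {q u v a : ℂ} (hq : q ≠ 0) (hu : u ≠ 0) (hv : v ≠ 0)
    (ha : a ^ 2 = u / v) (w : ℂ) (D r d : ℕ) (i : Fin (d + 1)) :
    qRacahSequence q d (a * q ^ (2 * (r : ℤ) + (d : ℤ) - (D : ℤ))) i =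
      (a * v)⁻¹ * (w + u * q ^ (2 * ((r + i : ℕ) : ℤ) - (D : ℤ))
        + v * q ^ ((D : ℤ) - 2 * ((r + i : ℕ) : ℤ)) - w) := by
  have ha0 : a ≠ 0 := by
    rintro rfl
    exact div_ne_zero hu hv (by rw [← ha]; simp)
  have hu' : u = a ^ 2 * v := by rw [ha, div_mul_cancel₀ _ hv]
  rw [qRacahSequence, mul_inv, ← zpow_neg, mul_assoc, mul_assoc, ← zpow_add₀ hq, ← zpow_add₀ hq,
    hu', show 2 * (r : ℤ) + d - D + (2 * (i : ℤ) - d) = 2 * ((r + i : ℕ) : ℤ) - D by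
      push_cast; ring,
    show -(2 * (r : ℤ) + d - D) + ((d : ℤ) - 2 * (i : ℤ)) = D - 2 * ((r + i : ℕ) : ℤ) by
      push_cast; ring]
  field_simp
  ring

/-! ### Leonard systems from tridiagonal pairs of complete systems -/

/-- Two operators, each irreducible tridiagonal with respect to the eigenspaces of the other, form a
Leonard system after restricting the idempotents to their supports and normalizing the operators
affinely. -/
theorem IsIrreducibleTridiagonal.isLeonardSystem {V : Type*} [AddCommGroup V] [Module ℂ V]
    {n d r t : ℕ} {S R : Module.End ℂ V} {P Q : Fin n → Module.End ℂ V}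
    (hSP : IsIrreducibleTridiagonal S P) (hRQ : IsIrreducibleTridiagonal R Q)
    {θ θs : Fin n → ℂ} (hS : S = ∑ i, θ i • Q i) (hR : R = ∑ i, θs i • P i)
    (hθ : Set.InjOn θ {i | Q i ≠ 0}) (hθs : Set.InjOn θs {i | P i ≠ 0})
    (hdim : Module.finrank ℂ V = d + 1)
    (hrd : r + d < n) (hP : ∀ i : Fin n, P i ≠ 0 ↔ r ≤ i ∧ (i : ℕ) ≤ r + d)
    (htd : t + d < n) (hQ : ∀ i : Fin n, Q i ≠ 0 ↔ t ≤ i ∧ (i : ℕ) ≤ t + d)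
    {c cs : ℂ} (hc : c ≠ 0) (hcs : cs ≠ 0) (s ss : ℂ) {α β : Fin (d + 1) → ℂ}
    (hα : ∀ i : Fin (d + 1), α i = c * (θ ⟨t + i, by omega⟩ - s))
    (hβ : ∀ i : Fin (d + 1), β i = cs * (θs ⟨r + i, by omega⟩ - ss)) :
    IsLeonardSystem d (c • (S - s • 1)) (fun i => Q ⟨t + i, by omega⟩)
        (cs • (R - ss • 1)) (fun i => P ⟨r + i, by omega⟩) ∧
      IsEigenvalueSequence (c • (S - s • 1)) (fun i => Q ⟨t + i, by omega⟩) α ∧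
      IsEigenvalueSequence (cs • (R - ss • 1)) (fun i => P ⟨r + i, by omega⟩) β := by
  have hQne : ∀ i : Fin (d + 1), Q ⟨t + i, by omega⟩ ≠ 0 := fun i =>
    (hQ _).2 ⟨by simp, by simp; omega⟩
  have hPne : ∀ i : Fin (d + 1), P ⟨r + i, by omega⟩ ≠ 0 := fun i =>
    (hP _).2 ⟨by simp, by simp; omega⟩
  have hQc := hRQ.complete.interval htd hQ
  have hPc := hSP.complete.interval hrd hP
  have hαinj : Function.Injective α := by
    intro i j hij
    rw [hα, hα] at hij
    have := hθ (hQne i) (hQne j) (sub_left_injective (mul_left_cancel₀ hc hij))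
    simpa [Fin.ext_iff] using this
  have hβinj : Function.Injective β := by
    intro i j hij
    rw [hβ, hβ] at hij
    have := hθs (hPne i) (hPne j) (sub_left_injective (mul_left_cancel₀ hcs hij))
    simpa [Fin.ext_iff] using this
  have hAQ : ∀ i : Fin (d + 1), (c • (S - s • (1 : Module.End ℂ V))) * Q ⟨t + i, by omega⟩ =
      α i • Q ⟨t + i, by omega⟩ := fun i => by
    rw [hα, affine_mul (hS ▸ hRQ.complete.sum_smul_mul θ _)]
  have hBP : ∀ i : Fin (d + 1), (cs • (R - ss • (1 : Module.End ℂ V))) * P ⟨r + i, by omega⟩ =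
      β i • P ⟨r + i, by omega⟩ := fun i => by
    rw [hβ, affine_mul (hR ▸ hSP.complete.sum_smul_mul θs _)]
  have hA := isEigenvalueSequence_of_mul_eq_smul hQc hQne hαinj hAQ
  have hB := isEigenvalueSequence_of_mul_eq_smul hPc hPne hβinj hBP
  have hneq : ∀ i j : Fin (d + 1), 1 ≤ |(i : ℤ) - (j : ℤ)| → i ≠ j := by
    rintro i _ h rfl
    simp at h
  refine ⟨⟨hdim, hA.isMultiplicityFree hQc hdim hαinj, hB.isMultiplicityFree hPc hdim hβinj,
    hA.isPrimitiveIdempotentOrdering hQc hQne hAQ, hB.isPrimitiveIdempotentOrdering hPc hPne hBP,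
    fun i j hij => ?_, fun i j hij => ?_, fun i j hij => ?_, fun i j hij => ?_⟩, hA, hB⟩
  · rw [mul_affine_mul (hQc.ortho (hneq i j hij.le)), hRQ.mul_eq_zero, smul_zero]
    simpa using hij
  · rw [mul_affine_mul (hQc.ortho (hneq i j hij.ge))]
    exact smul_ne_zero hcs (hRQ.mul_ne_zero (hQne i) (hQne j) (by simpa using hij))
  · rw [mul_affine_mul (hPc.ortho (hneq i j hij.le)), hSP.mul_eq_zero, smul_zero]
    simpa using hij
  · rw [mul_affine_mul (hPc.ortho (hneq i j hij.ge))]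
    exact smul_ne_zero hc (hSP.mul_ne_zero (hPne i) (hPne j) (by simpa using hij))

theorem mainTheorem5 {X : Type*} [Fintype X] [DecidableEq X]
    (G : SimpleGraph X) (hG : IsDistanceRegular G) (hD : 3 ≤ G.diam)
    (E : Fin (G.diam + 1) → Matrix X X ℂ) (hE : IsPrimitiveIdempotents G E)
    (hQ : IsQPolynomial G E) (x : X)
    (q : ℂ) (hq0 : q ≠ 0) (hq4 : q ^ 4 ≠ 1)
    -- the eigenvalues and the dual eigenvalues of the graph
    (θ θs : Fin (G.diam + 1) → ℂ)
    (hθ : distanceMatrix G 1 = ∑ i, θ i • E i)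
    (hθs : dualAdjacency G E x = ∑ i, θs i • dualIdempotent G x i)
    -- the structure has `q`-Racah type
    (u v w us vs ws : ℂ) (hu : u ≠ 0) (hv : v ≠ 0) (hus : us ≠ 0) (hvs : vs ≠ 0)
    (hθq : ∀ i : Fin (G.diam + 1), θ i = w + u * q ^ (2 * (i : ℤ) - (G.diam : ℤ))
      + v * q ^ ((G.diam : ℤ) - 2 * (i : ℤ)))
    (hθsq : ∀ i : Fin (G.diam + 1), θs i = ws + us * q ^ (2 * (i : ℤ) - (G.diam : ℤ))
      + vs * q ^ ((G.diam : ℤ) - 2 * (i : ℤ)))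
    (a b : ℂ) (ha : a ^ 2 = u / v) (hb : b ^ 2 = us / vs)
    (A B : Matrix X X ℂ)
    (hA : A = (a * v)⁻¹ • (distanceMatrix G 1 - w • (1 : Matrix X X ℂ)))
    (hB : B = (b * vs)⁻¹ • (dualAdjacency G E x - ws • (1 : Matrix X X ℂ)))
    -- a thin irreducible `T`-module
    (W : Submodule ℂ (X → ℂ)) (hW : IsIrreducibleTModule (subconstituentAlgebra G x) W)
    (hthin : IsThinModule G x W)
    (ρ τ d : ℕ) (hρ : ρ = moduleEndpoint G x W) (hτ : τ = moduleDualEndpoint G E W)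
    (hd : d = moduleDiameter G x W) :
    ∃ (hτd : τ + d ≤ G.diam) (hρd : ρ + d ≤ G.diam)
      (A' : Module.End ℂ W) (E' : Fin (d + 1) → Module.End ℂ W)
      (B' : Module.End ℂ W) (F' : Fin (d + 1) → Module.End ℂ W),
      ActsOnAs W A A' ∧
      (∀ i : Fin (d + 1), ActsOnAs W (E ⟨τ + i, by omega⟩) (E' i)) ∧
      ActsOnAs W B B' ∧
      (∀ i : Fin (d + 1), ActsOnAs W (dualIdempotent G x ⟨ρ + i, by omega⟩) (F' i)) ∧
      IsLeonardSystem d A' E' B' F' ∧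
      HasQRacahType q A' E' B' F' ∧
      IsEigenvalueSequence A' E'
        (qRacahSequence q d (a * q ^ (2 * (τ : ℤ) + (d : ℤ) - (G.diam : ℤ)))) ∧
      IsEigenvalueSequence B' F'
        (qRacahSequence q d (b * q ^ (2 * (ρ : ℤ) + (d : ℤ) - (G.diam : ℤ)))) := by
  have hc := hG.connected
  have hnezero : ∀ {s u v : ℂ}, u ≠ 0 → v ≠ 0 → s ^ 2 = u / v → s ≠ 0 := by
    rintro s u v hu hv hs rfl
    exact div_ne_zero hu hv (by rw [← hs]; simp)
  have ha0 : a ≠ 0 := hnezero hu hv ha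
  have hb0 : b ≠ 0 := hnezero hus hvs hb
  -- The generators as elements of the subconstituent algebra.
  have hAT : distanceMatrix G 1 ∈ subconstituentAlgebra G x :=
    boseMesner_le_subconstituentAlgebra G x (distanceMatrix_mem_boseMesner G)
  have hFT := dualIdempotent_mem_subconstituentAlgebra G x
  have hET : ∀ i, E i ∈ subconstituentAlgebra G x := fun i =>
    boseMesner_le_subconstituentAlgebra G x (hE.mem_boseMesner i)
  have hBT : dualAdjacency G E x ∈ subconstituentAlgebra G x := by
    rw [hθs]
    exact sum_mem fun i _ => Subalgebra.smul_mem _ (hFT i) _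
  set φ := hW.1.toEnd with hφ
  set S : Module.End ℂ W := φ ⟨_, hAT⟩ with hS
  set R : Module.End ℂ W := φ ⟨_, hBT⟩ with hR
  set P : Fin (G.diam + 1) → Module.End ℂ W := fun i => φ ⟨_, hFT i⟩ with hP
  set Q : Fin (G.diam + 1) → Module.End ℂ W := fun i => φ ⟨_, hET i⟩ with hQdef
  have hPc : CompleteOrthogonalIdempotents P :=
    (complete_dualIdempotent hc x).toEnd hW.1 hFT
  have hQc : CompleteOrthogonalIdempotents Q := hE.complete.toEnd hW.1 hET
  have hSsum : S = ∑ i, θ i • Q i := by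
    have e : (⟨_, hAT⟩ : subconstituentAlgebra G x) = ∑ i, θ i • ⟨_, hET i⟩ :=
      Subtype.ext (by simpa using hθ)
    rw [hS, e, map_sum]
    simp only [map_smul, hQdef]
  have hRsum : R = ∑ i, θs i • P i := by
    have e : (⟨_, hBT⟩ : subconstituentAlgebra G x) = ∑ i, θs i • ⟨_, hFT i⟩ :=
      Subtype.ext (by simpa using hθs)
    rw [hR, e, map_sum]
    simp only [map_smul, hP]
  have hθinj := hE.eigenvalue_injective hθ
  have hP0 : ∀ i, P i ≠ 0 → dualIdempotent G x i ≠ 0 := by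
    intro i hi h0
    refine hi ?_
    have e : (⟨_, hFT i⟩ : subconstituentAlgebra G x) = 0 := Subtype.ext h0
    simp only [hP]
    rw [e, map_zero]
  have hθsinj : Set.InjOn θs {i | P i ≠ 0} :=
    (injOn_dualEigenvalue hc hE hQ hθs).mono hP0
  have hSP : IsIrreducibleTridiagonal S P := by
    refine ⟨hPc, fun i j hij => ?_, fun U hU hPU => hW.eq_bot_or_eq_top hU hPU⟩
    simp only [hP, hS]
    rw [← map_mul, ← map_mul, ← map_zero φ]
    exact congrArg φ (Subtype.ext (dualIdempotent_mul_distanceMatrix_mul_eq_zero hc x hij))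
  have hRQ : IsIrreducibleTridiagonal R Q := by
    refine ⟨hQc, fun i j hij => ?_, fun U hU hQU => hW.eq_bot_or_eq_top (fun v hv => ?_) ?_⟩
    · obtain ⟨κ, hκ, hκQ⟩ := hQ
      simp only [hQdef, hR]
      rw [← map_mul, ← map_mul, ← map_zero φ]
      exact congrArg φ (Subtype.ext (hE.mul_dualAdjacency_mul_eq_zero hκ x ((hκQ i j).1 hij)))
    · change S v ∈ U
      rw [hSsum, LinearMap.sum_apply]
      exact U.sum_mem fun i _ => U.smul_mem _ (hQU i v hv)
    · -- The dual idempotents act as polynomials in the dual adjacency matrix.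
      intro i v hv
      obtain ⟨p, hp⟩ := hPc.exists_aeval_eq (R := Module.End ℂ W) hRsum hθsinj i
      change P i v ∈ U
      rw [← hp]
      exact aeval_apply_mem hU p hv
  -- Thinness, dual thinness, and the two supports.
  have hthinP : ∀ i, Module.finrank ℂ (LinearMap.range (P i)) ≤ 1 := fun i =>
    (hW.1.finrank_range_toEnd ⟨_, hFT i⟩).trans_le (hthin i)
  have hthinQ : ∀ i, Module.finrank ℂ (LinearMap.range (Q i)) ≤ 1 := fun i =>
    hSP.finrank_range_le_one hthinP (c := θ i) (by
      rw [hSsum]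
      exact CompleteOrthogonalIdempotents.sum_smul_mul (R := Module.End ℂ W) hQc θ i)
  have hPiff : ∀ i, matrixImage (dualIdempotent G x i) W ≠ ⊥ ↔ P i ≠ 0 := fun i =>
    hW.1.matrixImage_ne_bot_iff ⟨_, hFT i⟩
  have hQiff : ∀ i, matrixImage (E i) W ≠ ⊥ ↔ Q i ≠ 0 := fun i =>
    hW.1.matrixImage_ne_bot_iff ⟨_, hET i⟩
  have hPcard := hPc.ncard_eq_finrank hthinP
  have hQcard := hQc.ncard_eq_finrank hthinQ
  have hWpos : 0 < Module.finrank ℂ W := by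
    rw [Nat.pos_iff_ne_zero, Ne, Submodule.finrank_eq_zero]
    exact hW.2.1
  have hdim : Module.finrank ℂ W = d + 1 := by
    simp only [moduleDiameter, hPiff] at hd
    omega
  simp only [moduleEndpoint, hPiff] at hρ
  simp only [moduleDualEndpoint, hQiff] at hτ
  obtain ⟨hρd, hPsupp⟩ := hSP.ordConnected_support.mem_iff_of_fin
    (Set.nonempty_of_ncard_ne_zero (by omega)) hρ (hPcard.trans hdim)
  obtain ⟨hτd, hQsupp⟩ := hRQ.ordConnected_support.mem_iff_of_fin
    (Set.nonempty_of_ncard_ne_zero (by omega)) hτ (hQcard.trans hdim)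
  obtain ⟨hLeonard, hAseq, hBseq⟩ := hSP.isLeonardSystem hRQ hSsum hRsum hθinj.injOn hθsinj hdim
    hρd hPsupp hτd hQsupp (inv_ne_zero (mul_ne_zero ha0 hv)) (inv_ne_zero (mul_ne_zero hb0 hvs))
    w ws (fun i => (qRacahSequence_eq hq0 hu hv ha w G.diam τ d i).trans (by rw [hθq]))
    (fun i => (qRacahSequence_eq hq0 hus hvs hb ws G.diam ρ d i).trans (by rw [hθsq]))
  refine ⟨Nat.lt_succ_iff.1 hτd, Nat.lt_succ_iff.1 hρd, _, _, _, _, ?_,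
    fun i => hW.1.actsOnAs_toEnd ⟨_, hET _⟩, ?_, fun i => hW.1.actsOnAs_toEnd ⟨_, hFT _⟩,
    hLeonard, ⟨_, _, mul_ne_zero ha0 (zpow_ne_zero _ hq0), mul_ne_zero hb0 (zpow_ne_zero _ hq0),
      hAseq, hBseq⟩, hAseq, hBseq⟩
  · intro y
    rw [hA, Matrix.smul_mulVec, Matrix.sub_mulVec, Matrix.smul_mulVec, Matrix.one_mulVec]
    rfl
  · intro y
    rw [hB, Matrix.smul_mulVec, Matrix.sub_mulVec, Matrix.smul_mulVec, Matrix.one_mulVec]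
    rfl
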